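/- Let $a\ge 1$ be an integer, let $i\in\{-1,1\}$, and put $n=4a+6+i$. Consider the finite set $\Omega$ of labelled points, with $k=|\Omega|$, and the permutations $s,t$ of $\Omega$ given as follows. If $i=-1$, then $\Omega=\{1,\dots,2a,\,1',\dots,(2a)',\,\alpha,\alpha',\beta,\beta',\gamma,\delta,\epsilon\}$, so $k=n+2$, and $$s=(1,2,\dots,2a,\alpha,\beta,\gamma,\delta,\epsilon,(2a)',(2a-1)',\dots,2',1').$$ If $i=1$, then $\Omega=\{1,\dots,2a,\,1',\dots,(2a)',\,\alpha,\alpha',\beta,\beta',\gamma,\delta,\epsilon,\zeta\}$, so $k=n+1$, and $$s=(1,2,\dots,2a,\alpha,\alpha',\beta,\gamma,\delta,\epsilon,\zeta,(2a)',(2a-1)',\dots,2',1').$$ In both cases $$t=(\alpha,\alpha')(\beta,\beta')\prod_{j=1}^{2a}(j,j').$$ Define $r$ by $t=rs$ and let $G=\langle r,s\rangle$. Let $\mathcal M(G:r,s)$ be the map whose arcs (directed edges) are the elements of $G$, in which the arc following $g$ around its initial vertex is $gs$ and the reverse of the arc $g$ is $grs$, so that $G$ acts on it by left multiplication. Then $G$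 is the alternating group $A_k$ on $\Omega$; the elements $r$, $s$, $rs$ have orders $8$, $n$, $2$; and $\mathcal M(G:r,s)$ is a chiral map of type $\{8,n\}$. That is, $\mathcal M(G:r,s)$ is a map on an oriented surface with connected underlying graph, all its faces have length $8$ and all its vertices have valency $n$, its orientation-preserving automorphisms act transitively on its arcs, and it has no orientation-reversing automorphism; in terms of the group, no automorphism of $G$ maps $r$ to $r^{-1}$ and $s$ to $s^{-1}$. (In particular, for $a=1$ and $i=1$ the type is $\{8,11\}$ and $G=A_{12}$.) -/

import Mathlib

/-- An oriented combinatorial map on a set `D` of arcs (directed edges): `rot d` is the next arc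
after `d` around the initial vertex of `d`, in the positive sense of the orientation, and `rev d`
is the reverse of the arc `d`. -/
structure ArcSystem (D : Type*) where
  rot : Equiv.Perm D
  rev : Equiv.Perm D

namespace ArcSystem

variable {D : Type*} (M : ArcSystem D)

/-- The arc system describes a map, i.e. a cellular embedding of a (nonempty) connected graph in an
oriented surface: reversing an arc is an involution without fixed points, and the underlying graph
is connected. -/
structure IsMap : Prop where
  nonempty : Nonempty D
  rev_rev : ∀ d, M.rev (M.rev d) = d
  rev_ne : ∀ d, M.rev d ≠ d
  connected : ∀ d e, ∃ g ∈ Subgroup.closure {M.rot, M.rev}, g d = e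

/-- The next arc along the boundary of the face on the left of an arc: traverse the arc, then turn
left as sharply as possible. -/
def face : Equiv.Perm D := M.rot⁻¹ * M.rev

/-- Type `{m, n}`: every face has length `m` and every vertex has valency `n`. -/
def HasType (m n : ℕ) : Prop :=
  (∀ d, Function.minimalPeriod M.face d = m) ∧ (∀ d, Function.minimalPeriod M.rot d = n)

/-- The orientation-preserving automorphisms. -/
def autPlus : Subgroup (Equiv.Perm D) := Subgroup.centralizer {M.rot, M.rev}

/-- A map whose orientation-preserving automorphisms act transitively on the arcs. -/
def IsOrientablyRegular : Prop :=
  M.IsMap ∧ ∀ d e, ∃ φ ∈ M.autPlus, φ d = e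

/-- There is an orientation-reversing automorphism. -/
def IsReflexible : Prop :=
  ∃ φ : Equiv.Perm D, (∀ d, φ (M.rot d) = M.rot⁻¹ (φ d)) ∧ (∀ d, φ (M.rev d) = M.rev (φ d))

/-- Orientably-regular but not reflexible. -/
def IsChiral : Prop :=
  M.IsOrientablyRegular ∧ ¬ M.IsReflexible

end ArcSystem

/-- The map `M(G : r, s)` of a group `G` with elements `r`, `s`. Its arcs are the elements of `G`;
the element `h` of `G` acts as the automorphism `g ↦ h * g`. The base arc is `1`, and `s` and `r`
act as the one-step rotations about the initial vertex of the base arc and about the face to its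
left, while `r * s` reverses the base arc (it is a map if `r`, `s` generate `G` and `r * s` has
order two). -/
def regularMap {G : Type*} [Group G] (r s : G) : ArcSystem G where
  rot := Equiv.mulRight s
  rev := Equiv.mulRight (r * s)

/-- The points of the permutation diagram for `i = -1`. The points `1, …, 2a` are `num j` and the
points `1', …, 2a'` are `num' j`, where `j : Fin (2 * a)` has the value of the label minus one. -/
inductive PointsNeg (a : ℕ) : Type
  | num (j : Fin (2 * a))
  | num' (j : Fin (2 * a))
  | α | α' | β | β' | γ | δ | ε
  deriving DecidableEq, Fintype

/-- The points of the permutation diagram for `i = 1`, labelled in the same way. -/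
inductive PointsPos (a : ℕ) : Type
  | num (j : Fin (2 * a))
  | num' (j : Fin (2 * a))
  | α | α' | β | β' | γ | δ | ε | ζ
  deriving DecidableEq, Fintype

namespace PointsNeg

variable (a : ℕ)

/-- The product of the disjoint transpositions `(α, α')`, `(β, β')` and `(j, j')`. -/
def t : Equiv.Perm (PointsNeg a) :=
  Function.Involutive.toPerm
    (fun
      | num j => num' j
      | num' j => num j
      | α => α'
      | α' => α
      | β => β'
      | β' => β
      | γ => γ
      | δ => δ
      | ε => ε)
    (by intro x; cases x <;> rfl)

/-- The cycle `(1, 2, …, 2a, α, β, γ, δ, ε, 2a', …, 2', 1')`. -/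
def s : Equiv.Perm (PointsNeg a) :=
  List.formPerm
    ((List.finRange (2 * a)).map num ++ [α, β, γ, δ, ε] ++ (List.finRange (2 * a)).reverse.map num')

end PointsNeg

namespace PointsPos

variable (a : ℕ)

/-- The product of the disjoint transpositions `(α, α')`, `(β, β')` and `(j, j')`. -/
def t : Equiv.Perm (PointsPos a) :=
  Function.Involutive.toPerm
    (fun
      | num j => num' j
      | num' j => num j
      | α => α'
      | α' => α
      | β => β'
      | β' => β
      | γ => γ
      | δ => δ
      | ε => ε
      | ζ => ζ)
    (by intro x; cases x <;> rfl)

/-- The cycle `(1, 2, …, 2a, α, α', β, γ, δ, ε, ζ, 2a', …, 2', 1')`. -/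
def s : Equiv.Perm (PointsPos a) :=
  List.formPerm
    ((List.finRange (2 * a)).map num ++ [α, α', β, γ, δ, ε, ζ] ++
      (List.finRange (2 * a)).reverse.map num')

end PointsPos

section Generated

variable {Ω : Type*} (s t : Equiv.Perm Ω)

/-- The group `G` generated by `s` and by `r`, where `r` is given by `t = r * s`. -/
def genGroup : Subgroup (Equiv.Perm Ω) := Subgroup.closure {t * s⁻¹, s}

/-- `r` as an element of `G`. -/
def genR : genGroup s t := ⟨t * s⁻¹, Subgroup.subset_closure (by simp)⟩

/-- `s` as an element of `G`. -/
def genS : genGroup s t := ⟨s, Subgroup.subset_closure (by simp)⟩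

/-- The permutations `s` and `t` of the finite set `Ω` generate the alternating group `G` of `Ω`
and, with `t = r * s`, the map `M(G : r, s)` is chiral of type `{m, n}`. -/
structure GivesAlternatingChiralMap [Fintype Ω] [DecidableEq Ω] (m n : ℕ) : Prop where
  group_eq : genGroup s t = alternatingGroup Ω
  orderOf_r : orderOf (genR s t) = m
  orderOf_s : orderOf (genS s t) = n
  orderOf_rs : orderOf (genR s t * genS s t) = 2
  hasType : (regularMap (genR s t) (genS s t)).HasType m n
  isChiral : (regularMap (genR s t) (genS s t)).IsChiral
  /-- Chirality in terms of the group: no automorphism of `G` inverts both generators. -/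
  no_inverting_automorphism :
    ¬ ∃ φ : genGroup s t ≃* genGroup s t,
      φ (genR s t) = (genR s t)⁻¹ ∧ φ (genS s t) = (genS s t)⁻¹

end Generated

/-! Both `s` (a cycle of odd length) and `t` (a product of `2 * a + 2` transpositions) are even, so
`G` lies in the alternating group. By Jordan's theorem equality holds once `G` is primitive and
contains a 3-cycle. Primitivity comes from the few fixed points of `s`: a nontrivial block through
such a point absorbs the whole cycle of `s`, and then everything.

The rest is a computation independent of `a`. Along the pairs `j, j'` the involution `t` reverses
`s`, so `x = r ^ 2` is trivial there except near `α`, where it is a product of two 4-cycles. Hence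
`r` has order 8, and `x` and `y = s⁻² x s²` act on ten points only. An explicit word `w(x, y)` is a
3-cycle.

The same word gives chirality. An automorphism inverting `r` and `s`, followed by conjugation by
`s⁻²`, sends `(x, y)` to `(y⁻¹, x⁻¹)`. Since `w(x, y) ^ 3 = 1`, it would force `w(y⁻¹, x⁻¹) ^ 3 =
1`, which fails. An orientation-reversing map automorphism would yield such a group automorphism. -/

open scoped Pointwise

/-! ### Permutations: transport of transpositions, cycles, and a primitivity criterion -/

namespace Equiv.Perm

/-- Extending a permutation along an embedding sends transpositions to transpositions. -/
theorem viaEmbeddingHom_swap {α β : Type*} [DecidableEq α] [DecidableEq β] (f : α ↪ β) (i j : α) :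
    viaEmbeddingHom f (swap i j) = swap (f i) (f j) := by
  ext x
  rw [viaEmbeddingHom_apply]
  by_cases hx : x ∈ Set.range f
  · obtain ⟨k, rfl⟩ := hx
    rw [viaEmbedding_apply, f.injective.map_swap]
  · rw [viaEmbedding_apply_of_notMem _ _ _ hx, swap_apply_of_ne_of_ne]
    · rintro rfl
      exact hx ⟨i, rfl⟩
    · rintro rfl
      exact hx ⟨j, rfl⟩

theorem conj_swap {α : Type*} [DecidableEq α] (f : Perm α) (x y : α) :
    f * swap x y * f⁻¹ = swap (f x) (f y) := by
  rw [swap_apply_apply]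

theorem orderOf_formPerm {α : Type*} [DecidableEq α] [Fintype α] {l : List α} (hl : l.Nodup)
    (h2 : 2 ≤ l.length) : orderOf l.formPerm = l.length := by
  rw [(List.isCycle_formPerm hl h2).orderOf, List.support_formPerm_of_nodup l hl,
    List.toFinset_card_of_nodup hl]
  rintro x rfl
  simp at h2

theorem sign_formPerm_of_odd {α : Type*} [DecidableEq α] [Fintype α] {l : List α} (hl : l.Nodup)
    (h2 : 2 ≤ l.length) (hodd : Odd l.length) : sign l.formPerm = 1 := by
  rw [(List.isCycle_formPerm hl h2).sign, ← (List.isCycle_formPerm hl h2).orderOf,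
    orderOf_formPerm hl h2, hodd.neg_one_pow, neg_neg]

section Primitive

variable {Ω : Type*} {K : Subgroup (Perm Ω)} {s t : Perm Ω}

/-- A group containing a cycle `s` is transitive if another of its elements moves every fixed point
of `s` into the cycle. -/
theorem isPretransitive_of_isCycle_of_apply_ne (hs : s ∈ K) (ht : t ∈ K) (hcyc : s.IsCycle)
    (hfix : ∀ q, s q = q → s (t q) ≠ t q) : MulAction.IsPretransitive K Ω := by
  obtain ⟨c, hc, -⟩ := id hcyc
  have key : ∀ q, ∃ g : K, g • c = q := by
    have hmoved : ∀ q, s q ≠ q → ∃ g : K, g • c = q := fun q hq => by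
      obtain ⟨i, hi⟩ := hcyc.sameCycle hc hq
      exact ⟨⟨s ^ i, K.zpow_mem hs i⟩, hi⟩
    intro q
    by_cases hq : s q = q
    · obtain ⟨g, hg⟩ := hmoved _ (hfix q hq)
      refine ⟨⟨t, ht⟩⁻¹ * g, ?_⟩
      rw [mul_smul, hg, inv_smul_eq_iff]
      rfl
    · exact hmoved q hq
  refine ⟨fun x y => ?_⟩
  obtain ⟨g, rfl⟩ := key x
  obtain ⟨h, rfl⟩ := key y
  exact ⟨h * g⁻¹, by rw [mul_smul, inv_smul_smul]⟩

/-- A criterion for primitivity of a group containing a cycle `s` and an involution `t` which moves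
every fixed point of `s` into the cycle, in terms of the blocks that contain a fixed point `b`. -/
theorem isPreprimitive_of_isCycle (hs : s ∈ K) (ht : t ∈ K) (hcyc : s.IsCycle) (htt : t * t = 1)
    (hfix : ∀ q, s q = q → s (t q) ≠ t q) {b p : Ω} (hb : s b = b) (hp : s p ≠ p)
    (htp : s (t p) ≠ t p)
    (hother : ∀ q, q ≠ b → s q = q → ∃ g ∈ K, g b = q ∧ s (g q) ≠ g q) :
    MulAction.IsPreprimitive K Ω := by
  have := isPretransitive_of_isCycle_of_apply_ne hs ht hcyc hfix
  refine MulAction.IsPreprimitive.of_isTrivialBlock_base b fun {B} hbB hB => ?_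
  -- A translate of a block that meets the block equals it.
  have stable : ∀ g ∈ K, ∀ x ∈ B, g x ∈ B → ∀ y ∈ B, g y ∈ B := by
    intro g hg x hx hgx y hy
    have h := (MulAction.isBlock_iff_smul_eq_of_mem.1 hB) (g := (⟨g, hg⟩ : K)) hx hgx
    rw [← h]
    exact Set.smul_mem_smul_set hy
  by_cases hB1 : ∀ q ∈ B, q = b
  · exact Or.inl fun x hx y hy => (hB1 x hx).trans (hB1 y hy).symm
  right
  push Not at hB1
  obtain ⟨q, hq, hqb⟩ := hB1
  have hmoved : ∃ q ∈ B, s q ≠ q := by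
    by_cases hsq : s q = q
    · obtain ⟨g, hg, rfl, hgq⟩ := hother q hqb hsq
      exact ⟨_, stable g hg b hbB hq _ hq, hgq⟩
    · exact ⟨q, hq, hsq⟩
  obtain ⟨c, hcB, hc⟩ := hmoved
  -- Powers of `s` fix `b ∈ B`, hence preserve `B`; one moved point of `B` therefore brings in its
  -- whole cycle.
  have hsupp : ∀ x, s x ≠ x → x ∈ B := fun x hx => by
    obtain ⟨i, rfl⟩ := hcyc.sameCycle hc hx
    have hbi : (s ^ i) b = b := Function.IsFixedPt.perm_zpow hb i
    exact stable _ (K.zpow_mem hs i) b hbB (by rwa [hbi]) c hcB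
  refine Set.eq_univ_of_forall fun x => ?_
  by_cases hx : s x = x
  -- Both `p` and `t p` lie on the cycle, so `t` preserves `B`; and `x` is the image under `t` of
  -- the cycle point `t x`.
  · have := stable t ht p (hsupp p hp) (hsupp _ htp) _ (hsupp _ (hfix x hx))
    rwa [← mul_apply, htt] at this
  · exact hsupp x hx

end Primitive

end Equiv.Perm

/-! ### The map of a group: regularity, type, and reflections -/

section RegularMap

variable {G : Type*} [Group G] {r s : G}

theorem isOrientablyRegular_regularMap (hgen : Subgroup.closure {r, s} = ⊤)
    (hrs : orderOf (r * s) = 2) : (regularMap r s).IsOrientablyRegular := by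
  have hsq : r * s * (r * s) = 1 := by rw [← pow_two, ← hrs, pow_orderOf_eq_one]
  have hne : r * s ≠ 1 := fun h => by simp [h] at hrs
  refine ⟨⟨⟨1⟩, fun d => ?_, fun d => ?_, fun d e => ?_⟩, fun d e => ?_⟩
  · change d * (r * s) * (r * s) = d
    rw [mul_assoc, hsq, mul_one]
  · change d * (r * s) ≠ d
    rwa [Ne, mul_eq_left]
  · have key : ∀ h : G, Equiv.mulRight h ∈
        Subgroup.closure {(regularMap r s).rot, (regularMap r s).rev} := by
      have hs : Equiv.mulRight s ∈
          Subgroup.closure {(regularMap r s).rot, (regularMap r s).rev} :=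
        Subgroup.subset_closure (Or.inl rfl)
      have hrs' : Equiv.mulRight (r * s) ∈
          Subgroup.closure {(regularMap r s).rot, (regularMap r s).rev} :=
        Subgroup.subset_closure (Or.inr rfl)
      intro h
      have hh : h ∈ Subgroup.closure {r, s} := hgen ▸ Subgroup.mem_top h
      induction hh using Subgroup.closure_induction with
      | mem x hx =>
        rcases hx with rfl | rfl
        · have : Equiv.mulRight x = (Equiv.mulRight s)⁻¹ * Equiv.mulRight (x * s) := by
            rw [Equiv.inv_mulRight, ← Equiv.mulRight_mul, mul_inv_cancel_right]
          rw [this]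
          exact mul_mem (inv_mem hs) hrs'
        · exact hs
      | one => simp [one_mem]
      | mul x y _ _ hx hy =>
        rw [Equiv.mulRight_mul]
        exact mul_mem hy hx
      | inv x _ hx =>
        rw [← Equiv.inv_mulRight]
        exact inv_mem hx
    exact ⟨_, key (d⁻¹ * e), by simp⟩
  -- Left multiplications commute with the right multiplications defining the map.
  · refine ⟨Equiv.mulLeft (e * d⁻¹), ?_, by simp⟩
    rw [ArcSystem.autPlus, Subgroup.mem_centralizer_iff]
    rintro g (rfl | rfl) <;> ext x <;> simp [regularMap, mul_assoc]

theorem hasType_regularMap (r s : G) : (regularMap r s).HasType (orderOf r) (orderOf s) := by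
  have key : ∀ g d : G, Function.minimalPeriod (Equiv.mulRight g) d = orderOf g := by
    intro g d
    have hpow : ∀ n, (Equiv.mulRight g)^[n] d = d * g ^ n := by
      intro n
      induction n with
      | zero => simp
      | succ n ih => rw [Function.iterate_succ_apply', ih, pow_succ, ← mul_assoc]; rfl
    apply Nat.dvd_antisymm
    · apply Function.IsPeriodicPt.minimalPeriod_dvd
      rw [Function.IsPeriodicPt, Function.IsFixedPt, hpow, pow_orderOf_eq_one, mul_one]
    · apply orderOf_dvd_of_pow_eq_one
      have h := Function.isPeriodicPt_minimalPeriod (Equiv.mulRight g) d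
      rwa [Function.IsPeriodicPt, Function.IsFixedPt, hpow, mul_eq_left] at h
  refine ⟨fun d => ?_, fun d => key s d⟩
  have hface : (regularMap r s).face = Equiv.mulRight r := by
    rw [ArcSystem.face, regularMap, Equiv.inv_mulRight, ← Equiv.mulRight_mul,
      mul_inv_cancel_right]
  rw [hface, key]

/-- An orientation-reversing automorphism of `M(G : r, s)` yields an automorphism of `G` that
inverts both generators. -/
theorem exists_inverting_mulEquiv_of_isReflexible (hgen : Subgroup.closure {r, s} = ⊤)
    (hrs : r * s * (r * s) = 1) (h : (regularMap r s).IsReflexible) :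
    ∃ φ : G ≃* G, φ r = r⁻¹ ∧ φ s = s⁻¹ := by
  obtain ⟨φ, hrot, hrev⟩ := h
  have hφs : ∀ d, φ (d * s) = φ d * s⁻¹ := hrot
  have hφrs : ∀ d, φ (d * (r * s)) = φ d * (r * s) := hrev
  have hφr : ∀ d, φ (d * r) = φ d * (r * s * s) := fun d => by
    have h1 := hφrs d
    rw [← mul_assoc, hφs, mul_inv_eq_iff_eq_mul] at h1
    rw [h1, mul_assoc]
  have hmul : ∀ h : G, ∃ k, ∀ g, φ (g * h) = φ g * k := by
    intro h
    have hh : h ∈ Subgroup.closure {r, s} := hgen ▸ Subgroup.mem_top h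
    induction hh using Subgroup.closure_induction with
    | mem x hx =>
      rcases hx with rfl | rfl
      exacts [⟨_, hφr⟩, ⟨_, hφs⟩]
    | one => exact ⟨1, by simp⟩
    | mul x y _ _ hx hy =>
      obtain ⟨k, hk⟩ := hx
      obtain ⟨l, hl⟩ := hy
      exact ⟨k * l, fun g => by rw [← mul_assoc, hl, hk, mul_assoc]⟩
    | inv x _ hx =>
      obtain ⟨k, hk⟩ := hx
      exact ⟨k⁻¹, fun g => by rw [eq_mul_inv_iff_mul_eq, ← hk, inv_mul_cancel_right]⟩
  -- Thus `φ` becomes multiplicative once normalised to send `1` to `1`.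
  have hφmul : ∀ g h, φ (g * h) = φ g * ((φ 1)⁻¹ * φ h) := by
    intro g h
    obtain ⟨k, hk⟩ := hmul h
    have h1 := hk 1
    rw [one_mul] at h1
    rw [hk, h1, inv_mul_cancel_left]
  let ψ : G ≃* G :=
    { φ.trans (Equiv.mulLeft (φ 1)⁻¹) with
      map_mul' := fun g h => by simp [hφmul g h, mul_assoc] }
  have hψ : ∀ g, ψ g = (φ 1)⁻¹ * φ g := fun _ => rfl
  -- `ψ` sends `s` to `s⁻¹` but `r` to `r * s * s = s⁻¹ * r⁻¹ * s`, because `(r * s) ^ 2 = 1`;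
  -- conjugation by `s` corrects this.
  refine ⟨ψ.trans (MulAut.conj s), ?_, ?_⟩
  · have h1 := hφr 1
    rw [one_mul] at h1
    rw [MulEquiv.trans_apply, MulAut.conj_apply, hψ, h1, inv_mul_cancel_left,
      eq_inv_iff_mul_eq_one]
    have : s * (r * s * s) * s⁻¹ * r = s * (r * s * (r * s)) * s⁻¹ := by group
    rw [this, hrs, mul_one, mul_inv_cancel]
  · have h1 := hφs 1
    rw [one_mul] at h1
    rw [MulEquiv.trans_apply, MulAut.conj_apply, hψ, h1]
    group

end RegularMap

/-! ### From permutations to the alternating group and chirality -/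

section Generated

variable {Ω : Type*} {s t : Equiv.Perm Ω}

theorem closure_genR_genS : Subgroup.closure {genR s t, genS s t} = ⊤ := by
  have h := Subgroup.closure_closure_coe_preimage (k := {t * s⁻¹, s})
  have hpre : (Subtype.val ⁻¹' {t * s⁻¹, s} : Set (genGroup s t)) = {genR s t, genS s t} := by
    ext ⟨x, hx⟩
    simp [genR, genS, Subtype.ext_iff]
  rw [← hpre]
  exact h

theorem mem_genGroup_left : s ∈ genGroup s t := (genS s t).2

theorem mem_genGroup_right : t ∈ genGroup s t := by
  have h := mul_mem (genR s t).2 (genS s t).2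
  simpa [genR, genS] using h

/-- A word in `x = r ^ 2` and `y = s ^ (-2) * x * s ^ 2` that obstructs the existence of an
automorphism inverting `r` and `s`. -/
theorem not_exists_inverting_mulEquiv {x y : Equiv.Perm Ω} (hx : (t * s⁻¹) ^ 2 = x)
    (hy : s⁻¹ ^ 2 * x * s ^ 2 = y) (w : FreeGroup Bool)
    (h1 : FreeGroup.lift (fun b => cond b x y) w = 1)
    (h2 : FreeGroup.lift (fun b => cond b y⁻¹ x⁻¹) w ≠ 1) :
    ¬ ∃ φ : genGroup s t ≃* genGroup s t,
      φ (genR s t) = (genR s t)⁻¹ ∧ φ (genS s t) = (genS s t)⁻¹ := by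
  rintro ⟨φ, hr, hs⟩
  set R := genR s t
  set S := genS s t
  let F : FreeGroup Bool →* genGroup s t :=
    FreeGroup.lift (fun b => cond b (R ^ 2) (S⁻¹ ^ 2 * R ^ 2 * S ^ 2))
  have hR : ((R : genGroup s t) : Equiv.Perm Ω) = t * s⁻¹ := rfl
  have hS : ((S : genGroup s t) : Equiv.Perm Ω) = s := rfl
  have hF : (genGroup s t).subtype.comp F = FreeGroup.lift (fun b => cond b x y) := by
    ext1 b
    cases b <;> simp [F, hR, hS, hx, ← hy]
  have hconj : ∀ g : Equiv.Perm Ω,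
      (MulAut.conj (s⁻¹ ^ 2)) g = s⁻¹ ^ 2 * g * (s⁻¹ ^ 2)⁻¹ := fun _ => rfl
  -- The automorphism sends `x` to `x⁻¹` and `y` to `s² x⁻¹ s⁻²`; conjugation by `s⁻²` turns these
  -- into `y⁻¹` and `x⁻¹`.
  have hFφ : (MulAut.conj (s⁻¹ ^ 2)).toMonoidHom.comp
      ((genGroup s t).subtype.comp (φ.toMonoidHom.comp F)) =
      FreeGroup.lift (fun b => cond b y⁻¹ x⁻¹) := by
    ext1 b
    cases b
    · simp only [F, MonoidHom.comp_apply, FreeGroup.lift_apply_of, cond, MulEquiv.coe_toMonoidHom,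
        hconj, map_mul φ, map_pow φ, map_inv φ, hr, hs, Subgroup.coe_subtype, Subgroup.coe_mul,
        Subgroup.coe_pow, Subgroup.coe_inv, hR, hS, ← hx]
      simp [pow_two, mul_assoc]
    · simp only [F, MonoidHom.comp_apply, FreeGroup.lift_apply_of, cond, MulEquiv.coe_toMonoidHom,
        hconj, map_pow φ, hr, Subgroup.coe_subtype, Subgroup.coe_pow, Subgroup.coe_inv,
        hR, ← hx, ← hy]
      simp [pow_two, mul_assoc]
  have hw : F w = 1 := by
    rw [← hF] at h1
    simpa using h1
  apply h2
  rw [← hFφ]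
  simp [hw]

/-- Evenness of the generators gives one inclusion, Jordan's theorem on primitive groups with a
3-cycle the other; the map properties are formal consequences of the orders and of `hinv`. -/
theorem givesAlternatingChiralMap_of_isThreeCycle [Fintype Ω] [DecidableEq Ω] {m n : ℕ}
    (hsign_s : Equiv.Perm.sign s = 1) (hsign_t : Equiv.Perm.sign t = 1)
    (hr : orderOf (t * s⁻¹) = m) (hs : orderOf s = n) (ht : orderOf t = 2)
    (hprim : MulAction.IsPreprimitive (genGroup s t) Ω)
    {c : Equiv.Perm Ω} (hc : c.IsThreeCycle) (hcG : c ∈ genGroup s t)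
    (hinv : ¬ ∃ φ : genGroup s t ≃* genGroup s t,
      φ (genR s t) = (genR s t)⁻¹ ∧ φ (genS s t) = (genS s t)⁻¹) :
    GivesAlternatingChiralMap s t m n := by
  have hR : orderOf (genR s t) = m := by
    rw [← hr, ← Subgroup.orderOf_coe]
    rfl
  have hS : orderOf (genS s t) = n := by
    rw [← hs, ← Subgroup.orderOf_coe]
    rfl
  have hRS : orderOf (genR s t * genS s t) = 2 := by
    rw [← ht, ← Subgroup.orderOf_coe]
    simp [genR, genS]
  refine ⟨le_antisymm ?_ ?_, hR, hS, hRS, ?_, ⟨?_, fun h => hinv ?_⟩, hinv⟩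
  · rw [genGroup, Subgroup.closure_le]
    rintro g (rfl | rfl) <;> simp [Equiv.Perm.mem_alternatingGroup, hsign_s, hsign_t]
  · exact Equiv.Perm.alternatingGroup_le_of_isPreprimitive_of_isThreeCycle_mem hprim hc hcG
  · rw [← hR, ← hS]
    exact hasType_regularMap _ _
  · exact isOrientablyRegular_regularMap closure_genR_genS hRS
  · refine exists_inverting_mulEquiv_of_isReflexible closure_genR_genS ?_ h
    rw [← pow_two, ← hRS, pow_orderOf_eq_one]

end Generated

/-! ### Cycles that run out along one row and back along another -/

namespace List

variable {Ω : Type*}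

theorem formPerm_eq_of_getElem? [DecidableEq Ω] {l : List Ω} (hl : l.Nodup) {i : ℕ} {p q : Ω}
    (hp : l[i]? = some p) (hq : l[i + 1]? = some q) : l.formPerm p = q := by
  obtain ⟨hi, rfl⟩ := getElem?_eq_some_iff.1 hp
  obtain ⟨hi', rfl⟩ := getElem?_eq_some_iff.1 hq
  exact formPerm_apply_lt_getElem l hl i hi'

theorem formPerm_eq_of_getElem?_last [DecidableEq Ω] {l : List Ω} (hl : l.Nodup) {i : ℕ} {p q : Ω}
    (hi : i + 1 = l.length) (hp : l[i]? = some p) (hq : l[0]? = some q) : l.formPerm p = q := by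
  obtain ⟨hi, rfl⟩ := getElem?_eq_some_iff.1 hp
  obtain ⟨h0, rfl⟩ := getElem?_eq_some_iff.1 hq
  rw [formPerm_apply_getElem l hl i]
  simp [*]

/-- The list `f 0, …, f (N - 1)`, `mid`, `g (N - 1), …, g 0`. -/
def hairpin {N : ℕ} (f g : Fin N → Ω) (mid : List Ω) : List Ω :=
  (finRange N).map f ++ mid ++ (finRange N).reverse.map g

section Hairpin

variable {N : ℕ} {f g : Fin N → Ω} {mid : List Ω}

theorem length_hairpin : (hairpin f g mid).length = 2 * N + mid.length := by
  simp [hairpin]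
  ring

theorem nodup_hairpin (hf : f.Injective) (hg : g.Injective) (hmid : mid.Nodup)
    (hfg : ∀ i j, f i ≠ g j) (hfm : ∀ i, f i ∉ mid) (hgm : ∀ i, g i ∉ mid) :
    (hairpin f g mid).Nodup := by
  have h1 : ((finRange N).map f).Nodup := (nodup_finRange _).map hf
  have h2 : ((finRange N).reverse.map g).Nodup :=
    (nodup_reverse.2 (nodup_finRange _)).map hg
  simp only [hairpin, nodup_append, h1, h2, hmid]
  simp
  grind

theorem getElem?_hairpin_left (j : Fin N) : (hairpin f g mid)[(j : ℕ)]? = some (f j) := by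
  rw [hairpin, append_assoc, getElem?_append_left (by simp)]
  simp

theorem getElem?_hairpin_mid {i : ℕ} (hi : i < mid.length) :
    (hairpin f g mid)[N + i]? = mid[i]? := by
  rw [hairpin, append_assoc, getElem?_append_right (by simp), getElem?_append_left (by simpa)]
  simp

theorem getElem?_hairpin_right (j : Fin N) :
    (hairpin f g mid)[2 * N + mid.length - 1 - j]? = some (g j) := by
  have hj : 2 * N + mid.length - 1 - (j : ℕ) - (N + mid.length) = N - 1 - j := by omega
  rw [hairpin, getElem?_append_right (by simp; omega), getElem?_map]
  have hj' : N - 1 - (j : ℕ) < N := by omega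
  have hj'' : N - 1 - (N - 1 - (j : ℕ)) = j := by omega
  simp [hj, hj', hj'']

theorem mem_hairpin {p : Ω} :
    p ∈ hairpin f g mid ↔ (∃ j, f j = p) ∨ p ∈ mid ∨ ∃ j, g j = p := by
  simp [hairpin]

variable [DecidableEq Ω]

theorem formPerm_hairpin_left (hl : (hairpin f g mid).Nodup) {j k : Fin N}
    (h : (j : ℕ) + 1 = k) : (hairpin f g mid).formPerm (f j) = f k :=
  formPerm_eq_of_getElem? hl (getElem?_hairpin_left j) (h ▸ getElem?_hairpin_left k)

theorem formPerm_hairpin_left_last (hl : (hairpin f g mid).Nodup) {j : Fin N}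
    (h : (j : ℕ) + 1 = N) {q : Ω} (hq : mid[0]? = some q) :
    (hairpin f g mid).formPerm (f j) = q := by
  refine formPerm_eq_of_getElem? hl (getElem?_hairpin_left j) ?_
  rw [h, ← hq]
  exact getElem?_hairpin_mid (i := 0) (getElem?_eq_some_iff.1 hq).1

theorem formPerm_hairpin_mid (hl : (hairpin f g mid).Nodup) (i : ℕ) {p q : Ω}
    (hp : mid[i]? = some p) (hq : mid[i + 1]? = some q) :
    (hairpin f g mid).formPerm p = q := by
  refine formPerm_eq_of_getElem? hl (i := N + i) ?_ ?_
  · rw [getElem?_hairpin_mid (getElem?_eq_some_iff.1 hp).1, hp]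
  · rw [add_assoc, getElem?_hairpin_mid (getElem?_eq_some_iff.1 hq).1, hq]

theorem formPerm_hairpin_mid_last (hl : (hairpin f g mid).Nodup) {i : ℕ} {p : Ω} {j : Fin N}
    (hp : mid[i]? = some p) (hi : i + 1 = mid.length) (hj : (j : ℕ) + 1 = N) :
    (hairpin f g mid).formPerm p = g j := by
  refine formPerm_eq_of_getElem? hl (i := N + i) ?_ ?_
  · rw [getElem?_hairpin_mid (getElem?_eq_some_iff.1 hp).1, hp]
  · rw [← getElem?_hairpin_right (f := f) (mid := mid) j]
    congr 1
    omega

theorem formPerm_hairpin_right (hl : (hairpin f g mid).Nodup) {j k : Fin N}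
    (h : (j : ℕ) + 1 = k) : (hairpin f g mid).formPerm (g k) = g j := by
  refine formPerm_eq_of_getElem? hl (getElem?_hairpin_right k) ?_
  rw [← getElem?_hairpin_right (f := f) (mid := mid) j]
  congr 1
  omega

theorem formPerm_hairpin_right_last (hl : (hairpin f g mid).Nodup) {j : Fin N}
    (h : (j : ℕ) = 0) : (hairpin f g mid).formPerm (g j) = f j := by
  refine formPerm_eq_of_getElem?_last hl ?_ (getElem?_hairpin_right j) ?_
  · rw [length_hairpin]
    omega
  · rw [← getElem?_hairpin_left (f := f) (g := g) (mid := mid) j, h]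

end Hairpin

end List

open Equiv Equiv.Perm

/-- Moves the calculation with `x` and `y` into a fixed `Perm (Fin N)`, where it is decidable
uniformly in `a`. A single word `w` serves twice: its value is the 3-cycle for Jordan's theorem, and
`w ^ 3` is the relation that an inverting automorphism would violate. -/
theorem givesAlternatingChiralMap_of_viaEmbedding {Ω : Type*} {s t : Perm Ω} [Fintype Ω]
    [DecidableEq Ω] {n : ℕ} (hsign_s : sign s = 1) (hsign_t : sign t = 1)
    (hs : orderOf s = n) (ht : orderOf t = 2)
    (hprim : MulAction.IsPreprimitive (genGroup s t) Ω) {N : ℕ} (f : Fin N ↪ Ω)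
    {X Y : Perm (Fin N)} (hx : (t * s⁻¹) ^ 2 = viaEmbeddingHom f X)
    (hy : s⁻¹ ^ 2 * viaEmbeddingHom f X * s ^ 2 = viaEmbeddingHom f Y)
    (hX4 : X ^ 4 = 1) (hX2 : X ^ 2 ≠ 1) (w : FreeGroup Bool) {i j k : Fin N}
    (hij : i ≠ j) (hik : i ≠ k) (hjk : j ≠ k)
    (hw : FreeGroup.lift (fun b => cond b X Y) w = swap i j * swap i k)
    (hw' : FreeGroup.lift (fun b => cond b Y⁻¹ X⁻¹) w ^ 3 ≠ 1) :
    GivesAlternatingChiralMap s t 8 n := by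
  have hinj := viaEmbeddingHom_injective f
  have hr : t * s⁻¹ ∈ genGroup s t := (genR s t).2
  have hlift : FreeGroup.lift (fun b => cond b (viaEmbeddingHom f X) (viaEmbeddingHom f Y)) =
      (viaEmbeddingHom f).comp (FreeGroup.lift (fun b => cond b X Y)) := by
    ext1 b
    cases b <;> simp
  have hlift' :
      FreeGroup.lift (fun b => cond b (viaEmbeddingHom f Y)⁻¹ (viaEmbeddingHom f X)⁻¹) =
      (viaEmbeddingHom f).comp (FreeGroup.lift (fun b => cond b Y⁻¹ X⁻¹)) := by
    ext1 b
    cases b <;> simp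
  have hthree : (swap (f i) (f j) * swap (f i) (f k)).IsThreeCycle :=
    isThreeCycle_swap_mul_swap_same (f.injective.ne hij) (f.injective.ne hik) (f.injective.ne hjk)
  have himage : viaEmbeddingHom f (FreeGroup.lift (fun b => cond b X Y) w) =
      swap (f i) (f j) * swap (f i) (f k) := by
    rw [hw, map_mul, viaEmbeddingHom_swap, viaEmbeddingHom_swap]
  refine givesAlternatingChiralMap_of_isThreeCycle hsign_s hsign_t ?_ hs ht hprim hthree ?_
    (not_exists_inverting_mulEquiv hx hy (w ^ 3) ?_ ?_)
  -- The order of `r` is 8 because `r ^ 4` corresponds to `X ^ 2 ≠ 1` and `r ^ 8` to `X ^ 4 = 1`.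
  · refine orderOf_eq_prime_pow (p := 2) (n := 2) ?_ ?_
    · rw [pow_succ, pow_one, pow_mul, hx, ← map_pow, map_eq_one_iff _ hinj]
      exact hX2
    · rw [show 2 ^ (2 + 1) = 2 * 4 from rfl, pow_mul, hx, ← map_pow, hX4, map_one]
  · rw [← himage, ← MonoidHom.comp_apply, ← hlift]
    have hrange : (FreeGroup.lift
        (fun b => cond b (viaEmbeddingHom f X) (viaEmbeddingHom f Y))).range ≤ genGroup s t := by
      have hxG : viaEmbeddingHom f X ∈ genGroup s t := hx ▸ pow_mem hr 2
      refine FreeGroup.range_lift_le ?_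
      rintro _ ⟨b, rfl⟩
      cases b
      · simp only [cond, ← hy]
        exact mul_mem (mul_mem (pow_mem (inv_mem mem_genGroup_left) 2) hxG)
          (pow_mem mem_genGroup_left 2)
      · exact hxG
    exact hrange ⟨w, rfl⟩
  · rw [map_pow, hlift, MonoidHom.comp_apply, himage, ← hthree.orderOf, pow_orderOf_eq_one]
  · rw [map_pow, hlift', MonoidHom.comp_apply, ← map_pow, Ne, map_eq_one_iff _ hinj]
    exact hw'

/-! ### The case `i = -1` -/

namespace PointsNeg

variable {a : ℕ}

theorem nodup_hairpin (a : ℕ) :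
    (List.hairpin (num (a := a)) num' [α, β, γ, δ, ε]).Nodup :=
  List.nodup_hairpin (fun _ _ => num.inj) (fun _ _ => num'.inj) (by simp) (by simp) (by simp)
    (by simp)

theorem s_eq_formPerm (a : ℕ) :
    s a = (List.hairpin (num (a := a)) num' [α, β, γ, δ, ε]).formPerm := rfl

theorem two_le_length_hairpin (a : ℕ) :
    2 ≤ (List.hairpin (num (a := a)) num' [α, β, γ, δ, ε]).length := by
  simp [List.length_hairpin]

theorem s_num {j k : Fin (2 * a)} (h : (j : ℕ) + 1 = k) : s a (num j) = num k :=
  List.formPerm_hairpin_left (nodup_hairpin a) h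

theorem s_num_last {j : Fin (2 * a)} (h : (j : ℕ) + 1 = 2 * a) : s a (num j) = α :=
  List.formPerm_hairpin_left_last (nodup_hairpin a) h rfl

theorem s_α : s a α = β := List.formPerm_hairpin_mid (nodup_hairpin a) 0 rfl rfl

theorem s_β : s a β = γ := List.formPerm_hairpin_mid (nodup_hairpin a) 1 rfl rfl

theorem s_γ : s a γ = δ := List.formPerm_hairpin_mid (nodup_hairpin a) 2 rfl rfl

theorem s_δ : s a δ = ε := List.formPerm_hairpin_mid (nodup_hairpin a) 3 rfl rfl

theorem s_ε {j : Fin (2 * a)} (h : (j : ℕ) + 1 = 2 * a) : s a ε = num' j :=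
  List.formPerm_hairpin_mid_last (nodup_hairpin a) (i := 4) rfl rfl h

theorem s_num' {j k : Fin (2 * a)} (h : (j : ℕ) + 1 = k) : s a (num' k) = num' j :=
  List.formPerm_hairpin_right (nodup_hairpin a) h

theorem s_num'_zero {j : Fin (2 * a)} (h : (j : ℕ) = 0) : s a (num' j) = num j :=
  List.formPerm_hairpin_right_last (nodup_hairpin a) h

theorem s_apply_ne_iff {q : PointsNeg a} : s a q ≠ q ↔ q ≠ α' ∧ q ≠ β' := by
  rw [s_eq_formPerm]
  by_cases hq : q ∈ List.hairpin (num (a := a)) num' [α, β, γ, δ, ε]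
  · rw [List.formPerm_apply_mem_ne_self_iff _ (nodup_hairpin a) _ hq]
    simp only [List.length_hairpin, List.mem_hairpin] at hq ⊢
    cases q <;> simp_all
  · rw [List.formPerm_apply_of_notMem hq]
    rw [List.mem_hairpin] at hq
    cases q <;> simp_all

theorem card_eq (a : ℕ) : Fintype.card (PointsNeg a) = 4 * a + 7 := by
  have hl : (List.hairpin (num (a := a)) num' [α, α', β, β', γ, δ, ε]).Nodup :=
    List.nodup_hairpin (fun _ _ => num.inj) (fun _ _ => num'.inj) (by simp) (by simp) (by simp)
      (by simp)
  have huniv : (List.hairpin (num (a := a)) num' [α, α', β, β', γ, δ, ε]).toFinset =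
      Finset.univ := by
    ext q
    cases q <;> simp [List.mem_hairpin]
  rw [← Finset.card_univ, ← huniv, List.toFinset_card_of_nodup hl, List.length_hairpin]
  simp
  ring

theorem t_mul_t (a : ℕ) : t a * t a = 1 := by
  ext q
  cases q <;> rfl

theorem t_num (j : Fin (2 * a)) : t a (num j) = num' j := rfl
theorem t_num' (j : Fin (2 * a)) : t a (num' j) = num j := rfl
theorem t_α : t a α = α' := rfl
theorem t_α' : t a α' = α := rfl
theorem t_β : t a β = β' := rfl
theorem t_β' : t a β' = β := rfl
theorem t_γ : t a γ = γ := rfl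
theorem t_δ : t a δ = δ := rfl
theorem t_ε : t a ε = ε := rfl

theorem orderOf_t (a : ℕ) : orderOf (t a) = 2 := by
  refine orderOf_eq_prime (by rw [pow_two, t_mul_t]) fun h => ?_
  have := DFunLike.congr_fun h (α : PointsNeg a)
  simp [t_α] at this

theorem card_fixedPoints_t : Fintype.card (Function.fixedPoints (t a)) = 3 := by
  have h : Function.fixedPoints (t a) =
      (({γ, δ, ε} : Finset (PointsNeg a)) : Set (PointsNeg a)) := by
    ext q
    cases q <;> simp [Function.mem_fixedPoints, Function.IsFixedPt, t_num, t_num', t_α, t_α', t_β,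
      t_β', t_γ, t_δ, t_ε]
  simp_rw [h]
  simp

theorem sign_t (a : ℕ) : sign (t a) = 1 := by
  rw [sign_of_pow_two_eq_one (by rw [pow_two, t_mul_t]), card_fixedPoints_t, card_eq]
  exact Even.neg_one_pow ⟨a + 1, by omega⟩

theorem orderOf_s (a : ℕ) : orderOf (s a) = 4 * a + 5 := by
  rw [s_eq_formPerm, orderOf_formPerm (nodup_hairpin a) (two_le_length_hairpin a),
    List.length_hairpin]
  simp
  ring

theorem sign_s (a : ℕ) : sign (s a) = 1 := by
  rw [s_eq_formPerm]
  refine sign_formPerm_of_odd (nodup_hairpin a) (two_le_length_hairpin a) ⟨2 * a + 2, ?_⟩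
  rw [List.length_hairpin]
  simp
  ring

theorem isCycle_s (a : ℕ) : (s a).IsCycle :=
  List.isCycle_formPerm (nodup_hairpin a) (two_le_length_hairpin a)

theorem s_α' : s a α' = α' := by simpa using (s_apply_ne_iff (a := a) (q := α')).not

theorem s_β' : s a β' = β' := by simpa using (s_apply_ne_iff (a := a) (q := β')).not

theorem isPreprimitive_genGroup (a : ℕ) :
    MulAction.IsPreprimitive (genGroup (s a) (t a)) (PointsNeg a) := by
  have hs : s a ∈ genGroup (s a) (t a) := mem_genGroup_left
  have ht : t a ∈ genGroup (s a) (t a) := mem_genGroup_right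
  -- `γ` is on the cycle and fixed by `t`, so it serves as `p`.
  refine isPreprimitive_of_isCycle hs ht (isCycle_s a) (t_mul_t a) (b := α') (p := γ)
    (fun q hq => ?_) s_α' (by simp [s_apply_ne_iff]) (by simp [s_apply_ne_iff, t_γ])
    fun q hqα hq => ?_
  · rw [s_apply_ne_iff]
    contrapose hq
    rw [← Ne, s_apply_ne_iff]
    cases q <;> simp_all [t_α, t_β, t_num, t_num', t_α', t_β']
  · have hqβ : q = β' := by
      by_contra h
      exact s_apply_ne_iff.2 ⟨hqα, h⟩ hq
    subst hqβ
    -- The path is `α' ↦ α ↦ β ↦ β'`, while `β' ↦ β ↦ γ ↦ γ` lands on the cycle.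
    refine ⟨t a * s a * t a, mul_mem (mul_mem ht hs) ht, ?_, ?_⟩ <;>
      simp [t_α', s_α, t_β, t_β', s_β, t_γ, s_γ]

/-- The points near `α` that are moved by `r ^ 2` or by its conjugate under `s ^ 2`. -/
def localPoints (j k : Fin (2 * a)) (h : (j : ℕ) + 1 = k) : Fin 10 ↪ PointsNeg a where
  toFun := ![num j, num k, α, β, γ, δ, ε, num' k, α', β']
  inj' := by
    have hjk : j ≠ k := by rintro rfl; omega
    intro x y
    fin_cases x <;> fin_cases y <;> simp [hjk, hjk.symm]

/-- Since `r⁻¹ = s * t`, it suffices to compute `(s * t) ^ 2`. Away from the middle, `s * t`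
exchanges `num j` with `num' (j - 1)` and fixes the first `num`, so its square is trivial there. -/
theorem r_sq {k : Fin (2 * a)} (hk : (k : ℕ) + 1 = 2 * a) :
    (t a * (s a)⁻¹) ^ 2 = swap α ε * swap ε γ * swap γ β *
      (swap α' (num' k) * swap (num' k) δ * swap δ β') := by
  have key : swap α ε * swap ε γ * swap γ β *
      (swap α' (num' k) * swap (num' k) δ * swap δ β') * (s a * t a) ^ 2 = 1 := by
    ext1 q
    simp only [pow_two, Perm.mul_apply, Perm.one_apply]
    cases q with
    | num j =>
      rw [t_num]
      obtain hj | ⟨i, hi⟩ : (j : ℕ) = 0 ∨ ∃ i : Fin (2 * a), (i : ℕ) + 1 = j := by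
        rcases Nat.eq_zero_or_pos j with h | h
        · exact Or.inl h
        · exact Or.inr ⟨⟨j - 1, by omega⟩, by simp; omega⟩
      · rw [s_num'_zero hj, t_num, s_num'_zero hj]
        simp [swap_apply_def]
      · rw [s_num' hi, t_num', s_num hi]
        simp [swap_apply_def]
    | num' j =>
      rw [t_num']
      by_cases hj : (j : ℕ) + 1 = 2 * a
      · obtain rfl : j = k := Fin.ext (by omega)
        rw [s_num_last hj, t_α, s_α']
        simp [swap_apply_def]
      · have hjk : j ≠ k := by rintro rfl; exact hj hk
        have hi : (j : ℕ) + 1 = (⟨j + 1, by omega⟩ : Fin (2 * a)) := rfl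
        rw [s_num hi, t_num, s_num' hi]
        simp [swap_apply_def, hjk]
    | _ =>
      simp [t_α, t_α', t_β, t_β', t_γ, t_δ, t_ε, s_α, s_α', s_β, s_β', s_γ, s_δ, s_ε hk, t_num',
        s_num_last hk, swap_apply_def]
  rw [eq_comm, ← mul_inv_eq_one]
  simpa [mul_inv_rev, pow_two, inv_eq_of_mul_eq_one_left (t_mul_t a)] using key

/-- Conjugation relabels each transposition, so only the values of `s ^ 2` at the points involved
matter. -/
theorem conj_r_sq {j k : Fin (2 * a)} (h : (j : ℕ) + 1 = k) (hk : (k : ℕ) + 1 = 2 * a) :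
    (s a)⁻¹ ^ 2 * (swap α ε * swap ε γ * swap γ β *
      (swap α' (num' k) * swap (num' k) δ * swap δ β')) * s a ^ 2 =
    swap (num j) γ * swap γ α * swap α (num k) * (swap α' δ * swap δ β * swap β β') := by
  have key : swap α ε * swap ε γ * swap γ β *
      (swap α' (num' k) * swap (num' k) δ * swap δ β') =
      s a ^ 2 * (swap (num j) γ * swap γ α * swap α (num k) *
        (swap α' δ * swap δ β * swap β β')) * (s a ^ 2)⁻¹ := by
    simp only [← MulAut.conj_apply, map_mul]
    simp only [MulAut.conj_apply, conj_swap]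
    simp [pow_two, s_num h, s_num_last hk, s_α, s_β, s_γ, s_δ, s_ε hk, s_α', s_β']
  rw [key]
  group

set_option maxRecDepth 20000 in
theorem givesAlternatingChiralMap (ha : 1 ≤ a) :
    GivesAlternatingChiralMap (s a) (t a) 8 (4 * a + 6 - 1) := by
  let j : Fin (2 * a) := ⟨2 * a - 2, by omega⟩
  let k : Fin (2 * a) := ⟨2 * a - 1, by omega⟩
  have hjk : (j : ℕ) + 1 = k := by simp [j, k]; omega
  have hk : (k : ℕ) + 1 = 2 * a := by simp [k]; omega
  refine givesAlternatingChiralMap_of_viaEmbedding (sign_s a) (sign_t a) (orderOf_s a)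
    (orderOf_t a) (isPreprimitive_genGroup a) (localPoints j k hjk)
    (X := swap 2 6 * swap 6 4 * swap 4 3 * (swap 8 7 * swap 7 5 * swap 5 9))
    (Y := swap 0 4 * swap 4 2 * swap 2 1 * (swap 8 5 * swap 5 3 * swap 3 9)) ?_ ?_ ?_ ?_
    -- `X ^ 2 * Y` is a 3-cycle times a disjoint 5-cycle, so its fifth power is a 3-cycle. Its
    -- counterpart `Y⁻¹ ^ 2 * X⁻¹` is a 9-cycle, whose 15th power is not trivial.
    ((FreeGroup.of true ^ 2 * FreeGroup.of false) ^ 5) (i := 0) (j := 2) (k := 1)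
    (by decide) (by decide) (by decide) ?_ ?_
  · simp only [map_mul, viaEmbeddingHom_swap]
    exact r_sq hk
  · simp only [map_mul, viaEmbeddingHom_swap]
    exact conj_r_sq hjk hk
  · exact Equiv.ext (by decide)
  · exact fun h => absurd (DFunLike.congr_fun h 2) (by decide)
  · simp only [map_pow, map_mul, FreeGroup.lift_apply_of, cond]
    exact Equiv.ext (by decide)
  · simp only [map_pow, map_mul, FreeGroup.lift_apply_of, cond]
    exact fun h => absurd (DFunLike.congr_fun h 0) (by decide)

end PointsNeg

/-! ### The case `i = 1`, where `β'` is the only fixed point of `s` -/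

namespace PointsPos

variable {a : ℕ}

theorem nodup_hairpin (a : ℕ) :
    (List.hairpin (num (a := a)) num' [α, α', β, γ, δ, ε, ζ]).Nodup :=
  List.nodup_hairpin (fun _ _ => num.inj) (fun _ _ => num'.inj) (by simp) (by simp) (by simp)
    (by simp)

theorem s_eq_formPerm (a : ℕ) :
    s a = (List.hairpin (num (a := a)) num' [α, α', β, γ, δ, ε, ζ]).formPerm := rfl

theorem two_le_length_hairpin (a : ℕ) :
    2 ≤ (List.hairpin (num (a := a)) num' [α, α', β, γ, δ, ε, ζ]).length := by
  simp [List.length_hairpin]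

theorem s_num {j k : Fin (2 * a)} (h : (j : ℕ) + 1 = k) : s a (num j) = num k :=
  List.formPerm_hairpin_left (nodup_hairpin a) h

theorem s_num_last {j : Fin (2 * a)} (h : (j : ℕ) + 1 = 2 * a) : s a (num j) = α :=
  List.formPerm_hairpin_left_last (nodup_hairpin a) h rfl

theorem s_α : s a α = α' := List.formPerm_hairpin_mid (nodup_hairpin a) 0 rfl rfl

theorem s_α' : s a α' = β := List.formPerm_hairpin_mid (nodup_hairpin a) 1 rfl rfl

theorem s_β : s a β = γ := List.formPerm_hairpin_mid (nodup_hairpin a) 2 rfl rfl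

theorem s_γ : s a γ = δ := List.formPerm_hairpin_mid (nodup_hairpin a) 3 rfl rfl

theorem s_δ : s a δ = ε := List.formPerm_hairpin_mid (nodup_hairpin a) 4 rfl rfl

theorem s_ε : s a ε = ζ := List.formPerm_hairpin_mid (nodup_hairpin a) 5 rfl rfl

theorem s_ζ {j : Fin (2 * a)} (h : (j : ℕ) + 1 = 2 * a) : s a ζ = num' j :=
  List.formPerm_hairpin_mid_last (nodup_hairpin a) (i := 6) rfl rfl h

theorem s_num' {j k : Fin (2 * a)} (h : (j : ℕ) + 1 = k) : s a (num' k) = num' j :=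
  List.formPerm_hairpin_right (nodup_hairpin a) h

theorem s_num'_zero {j : Fin (2 * a)} (h : (j : ℕ) = 0) : s a (num' j) = num j :=
  List.formPerm_hairpin_right_last (nodup_hairpin a) h

theorem s_apply_ne_iff {q : PointsPos a} : s a q ≠ q ↔ q ≠ β' := by
  rw [s_eq_formPerm]
  by_cases hq : q ∈ List.hairpin (num (a := a)) num' [α, α', β, γ, δ, ε, ζ]
  · rw [List.formPerm_apply_mem_ne_self_iff _ (nodup_hairpin a) _ hq]
    simp only [List.length_hairpin, List.mem_hairpin] at hq ⊢
    cases q <;> simp_all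
  · rw [List.formPerm_apply_of_notMem hq]
    rw [List.mem_hairpin] at hq
    cases q <;> simp_all

theorem card_eq (a : ℕ) : Fintype.card (PointsPos a) = 4 * a + 8 := by
  have hl : (List.hairpin (num (a := a)) num' [α, α', β, β', γ, δ, ε, ζ]).Nodup :=
    List.nodup_hairpin (fun _ _ => num.inj) (fun _ _ => num'.inj) (by simp) (by simp) (by simp)
      (by simp)
  have huniv : (List.hairpin (num (a := a)) num' [α, α', β, β', γ, δ, ε, ζ]).toFinset =
      Finset.univ := by
    ext q
    cases q <;> simp [List.mem_hairpin]
  rw [← Finset.card_univ, ← huniv, List.toFinset_card_of_nodup hl, List.length_hairpin]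
  simp
  ring

theorem t_mul_t (a : ℕ) : t a * t a = 1 := by
  ext q
  cases q <;> rfl

theorem t_num (j : Fin (2 * a)) : t a (num j) = num' j := rfl
theorem t_num' (j : Fin (2 * a)) : t a (num' j) = num j := rfl
theorem t_α : t a α = α' := rfl
theorem t_α' : t a α' = α := rfl
theorem t_β : t a β = β' := rfl
theorem t_β' : t a β' = β := rfl
theorem t_γ : t a γ = γ := rfl
theorem t_δ : t a δ = δ := rfl
theorem t_ε : t a ε = ε := rfl
theorem t_ζ : t a ζ = ζ := rfl

theorem orderOf_t (a : ℕ) : orderOf (t a) = 2 := by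
  refine orderOf_eq_prime (by rw [pow_two, t_mul_t]) fun h => ?_
  have := DFunLike.congr_fun h (α : PointsPos a)
  simp [t_α] at this

theorem card_fixedPoints_t : Fintype.card (Function.fixedPoints (t a)) = 4 := by
  have h : Function.fixedPoints (t a) =
      (({γ, δ, ε, ζ} : Finset (PointsPos a)) : Set (PointsPos a)) := by
    ext q
    cases q <;> simp [Function.mem_fixedPoints, Function.IsFixedPt, t_num, t_num', t_α, t_α', t_β,
      t_β', t_γ, t_δ, t_ε, t_ζ]
  simp_rw [h]
  simp

theorem sign_t (a : ℕ) : sign (t a) = 1 := by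
  rw [sign_of_pow_two_eq_one (by rw [pow_two, t_mul_t]), card_fixedPoints_t, card_eq]
  exact Even.neg_one_pow ⟨a + 1, by omega⟩

theorem orderOf_s (a : ℕ) : orderOf (s a) = 4 * a + 7 := by
  rw [s_eq_formPerm, orderOf_formPerm (nodup_hairpin a) (two_le_length_hairpin a),
    List.length_hairpin]
  simp
  ring

theorem sign_s (a : ℕ) : sign (s a) = 1 := by
  rw [s_eq_formPerm]
  refine sign_formPerm_of_odd (nodup_hairpin a) (two_le_length_hairpin a) ⟨2 * a + 3, ?_⟩
  rw [List.length_hairpin]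
  simp
  ring

theorem isCycle_s (a : ℕ) : (s a).IsCycle :=
  List.isCycle_formPerm (nodup_hairpin a) (two_le_length_hairpin a)

theorem s_β' : s a β' = β' := by simpa using (s_apply_ne_iff (a := a) (q := β')).not

theorem isPreprimitive_genGroup (a : ℕ) :
    MulAction.IsPreprimitive (genGroup (s a) (t a)) (PointsPos a) := by
  have hs : s a ∈ genGroup (s a) (t a) := mem_genGroup_left
  have ht : t a ∈ genGroup (s a) (t a) := mem_genGroup_right
  refine isPreprimitive_of_isCycle hs ht (isCycle_s a) (t_mul_t a) (b := β') (p := γ)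
    (fun q hq => ?_) s_β' (by simp [s_apply_ne_iff]) (by simp [s_apply_ne_iff, t_γ])
    fun q hqβ hq => absurd hq (s_apply_ne_iff.2 hqβ)
  obtain rfl : q = β' := by
    by_contra h
    exact s_apply_ne_iff.2 h hq
  simp [s_apply_ne_iff, t_β']

/-- The points near `α` that are moved by `r ^ 2` or by its conjugate under `s ^ 2`. -/
def localPoints (j k : Fin (2 * a)) : Fin 10 ↪ PointsPos a where
  toFun := ![num j, α, α', β, γ, δ, ε, ζ, num' k, β']
  inj' := by
    intro x y
    fin_cases x <;> fin_cases y <;> simp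

theorem r_sq {k : Fin (2 * a)} (hk : (k : ℕ) + 1 = 2 * a) :
    (t a * (s a)⁻¹) ^ 2 = swap α ζ * swap ζ δ * swap δ β' *
      (swap β (num' k) * swap (num' k) ε * swap ε γ) := by
  have key : swap α ζ * swap ζ δ * swap δ β' *
      (swap β (num' k) * swap (num' k) ε * swap ε γ) * (s a * t a) ^ 2 = 1 := by
    ext1 q
    simp only [pow_two, Perm.mul_apply, Perm.one_apply]
    cases q with
    | num j =>
      rw [t_num]
      obtain hj | ⟨i, hi⟩ : (j : ℕ) = 0 ∨ ∃ i : Fin (2 * a), (i : ℕ) + 1 = j := by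
        rcases Nat.eq_zero_or_pos j with h | h
        · exact Or.inl h
        · exact Or.inr ⟨⟨j - 1, by omega⟩, by simp; omega⟩
      · rw [s_num'_zero hj, t_num, s_num'_zero hj]
        simp [swap_apply_def]
      · rw [s_num' hi, t_num', s_num hi]
        simp [swap_apply_def]
    | num' j =>
      rw [t_num']
      by_cases hj : (j : ℕ) + 1 = 2 * a
      · obtain rfl : j = k := Fin.ext (by omega)
        rw [s_num_last hj, t_α, s_α']
        simp [swap_apply_def]
      · have hjk : j ≠ k := by rintro rfl; exact hj hk
        have hi : (j : ℕ) + 1 = (⟨j + 1, by omega⟩ : Fin (2 * a)) := rfl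
        rw [s_num hi, t_num, s_num' hi]
        simp [swap_apply_def, hjk]
    | _ =>
      simp [t_α, t_α', t_β, t_β', t_γ, t_δ, t_ε, t_ζ, s_α, s_α', s_β, s_β', s_γ, s_δ, s_ε, s_ζ hk, t_num',
        s_num_last hk, swap_apply_def]
  rw [eq_comm, ← mul_inv_eq_one]
  simpa [mul_inv_rev, pow_two, inv_eq_of_mul_eq_one_left (t_mul_t a)] using key

theorem conj_r_sq {j k : Fin (2 * a)} (h : (j : ℕ) + 1 = k) (hk : (k : ℕ) + 1 = 2 * a) :
    (s a)⁻¹ ^ 2 * (swap α ζ * swap ζ δ * swap δ β' *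
      (swap β (num' k) * swap (num' k) ε * swap ε γ)) * s a ^ 2 =
    swap (num j) δ * swap δ β * swap β β' * (swap α ε * swap ε γ * swap γ α') := by
  have key : swap α ζ * swap ζ δ * swap δ β' *
      (swap β (num' k) * swap (num' k) ε * swap ε γ) =
      s a ^ 2 * (swap (num j) δ * swap δ β * swap β β' *
        (swap α ε * swap ε γ * swap γ α')) * (s a ^ 2)⁻¹ := by
    simp only [← MulAut.conj_apply, map_mul]
    simp only [MulAut.conj_apply, conj_swap]
    simp [pow_two, s_num h, s_num_last hk, s_α, s_β, s_γ, s_δ, s_ε, s_ζ hk, s_α', s_β']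
  rw [key]
  group

set_option maxRecDepth 20000 in
theorem givesAlternatingChiralMap (ha : 1 ≤ a) :
    GivesAlternatingChiralMap (s a) (t a) 8 (4 * a + 6 + 1) := by
  let j : Fin (2 * a) := ⟨2 * a - 2, by omega⟩
  let k : Fin (2 * a) := ⟨2 * a - 1, by omega⟩
  have hjk : (j : ℕ) + 1 = k := by simp [j, k]; omega
  have hk : (k : ℕ) + 1 = 2 * a := by simp [k]; omega
  refine givesAlternatingChiralMap_of_viaEmbedding (sign_s a) (sign_t a) (orderOf_s a)
    (orderOf_t a) (isPreprimitive_genGroup a) (localPoints j k)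
    (X := swap 1 7 * swap 7 5 * swap 5 9 * (swap 3 8 * swap 8 6 * swap 6 4))
    (Y := swap 0 5 * swap 5 3 * swap 3 9 * (swap 1 6 * swap 6 4 * swap 4 2)) ?_ ?_ ?_ ?_
    -- The inner word has cycle type 7 + 3, so its seventh power is a 3-cycle. After the
    -- substitution it has cycle type 5 + 5, so its 21st power is not trivial.
    ((FreeGroup.of true ^ 2 * (FreeGroup.of false)⁻¹ * FreeGroup.of true * FreeGroup.of false) ^ 7)
    (i := 4) (j := 5) (k := 8)
    (by decide) (by decide) (by decide) ?_ ?_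
  · simp only [map_mul, viaEmbeddingHom_swap]
    exact r_sq hk
  · simp only [map_mul, viaEmbeddingHom_swap]
    exact conj_r_sq hjk hk
  · exact Equiv.ext (by decide)
  · exact fun h => absurd (DFunLike.congr_fun h 1) (by decide)
  · simp only [map_pow, map_mul, map_inv, FreeGroup.lift_apply_of, cond]
    exact Equiv.ext (by decide)
  · simp only [map_pow, map_mul, map_inv, FreeGroup.lift_apply_of, cond]
    exact fun h => absurd (DFunLike.congr_fun h 0) (by decide)

end PointsPos

theorem proposition3p3 (a : ℕ) (ha : 1 ≤ a) :
    (Fintype.card (PointsNeg a) = (4 * a + 6 - 1) + 2 ∧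
      GivesAlternatingChiralMap (PointsNeg.s a) (PointsNeg.t a) 8 (4 * a + 6 - 1)) ∧
    (Fintype.card (PointsPos a) = (4 * a + 6 + 1) + 1 ∧
      GivesAlternatingChiralMap (PointsPos.s a) (PointsPos.t a) 8 (4 * a + 6 + 1)) := by
  exact ⟨⟨PointsNeg.card_eq a, PointsNeg.givesAlternatingChiralMap ha⟩,
    ⟨PointsPos.card_eq a, PointsPos.givesAlternatingChiralMap ha⟩⟩
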